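/- For a positive integer $N$ and a set $S$ of positive divisors of $N$ that are less than $N$, let $\mathrm{ICG}_N(S)$ be the integral circulant graph with vertex set $\mathbb{Z}_N$ in which $j$ and $k$ are adjacent if and only if $j\neq k$ and $\gcd(k-j,N)\in S$. A graph with adjacency matrix $A$ has perfect state transfer from vertex $a$ to vertex $b$ at time $t$ if $|\langle b|e^{-itA}|a\rangle|=1$. For an $n$-vertex graph $G$ with adjacency matrix $A_G$ and a Boolean (i.e. $0/1$) $n\times n$ matrix $C$, let $G\bowtie_C G$ be the graph on two copies of the vertex set of $G$ (the vertex $v$ in copy $s\in\{0,1\}$ being written $(v,s)$) with adjacency matrix $\begin{bmatrix}A_G & C\\ C^{T} & A_G\end{bmatrix}$. Let $I_n,J_n,O_n$ be the identity, all-one and zero $n\times n$ matrices. **Theorem.** Let $n=2^u m$, where $u\ge 3$ and $m\ge 3$ is odd, let $D=\{1,n/4\}$ or $D=\{1,n/2\}$, and let $G=\mathrm{ICG}_n(D)$. For every set $Q$ of positive divisors of $m$ there is a Boolean circulant $n\times n$ matrix $C$ (with rows and columns indexed by $\mathbb{Z}_n$ and entries $C_{j,k}=c_{k-j \bmod n}$),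 palindromic in the sense that $c_j=c_{n-1-j}$ for $0\le j\le n-1$, such that: 1. $C\neq I_n$; if $Q\neq\emptyset$, then $C\ne O_n$; and if $Q$ is not the set of all positive divisors of $m$, then $C\neq J_n$. In particular $C\notin\{I_n,J_n,O_n\}$ whenever $Q$ is a nonempty proper subset of the set of divisors of $m$. 2. $G\bowtie_C G=\mathrm{ICG}_{2n}(2D\cup Q)$, where $2D=\{2d:d\in D\}$ and the vertices are identified by $(v,s)\mapsto 2v+s$ for $0\le v\le n-1$, $s\in\{0,1\}$. 3. $G\bowtie_C G$ has perfect state transfer from $(0,0)$ to $(n/2,0)$ at time $\pi/2$; equivalently, $\mathrm{ICG}_{2n}(2D\cup Q)$ has perfect state transfer from $0$ to $n$ at time $\pi/2$. -/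

import Mathlib

/-- The residues `k` modulo `n`, with representative in `{1, …, n - 1}`, such that
`gcd (n, k) = d`. -/
def gcdClass (n d : ℕ) : Set (ZMod n) :=
  {k | k ≠ 0 ∧ Nat.gcd n k.val = d}

/-- The integral circulant graph `ICG_n(D)`: the vertices are the residues modulo `n`, and two
vertices are adjacent when their difference lies in one of the classes `gcdClass n d`, `d ∈ D`. -/
def integralCirculant (n : ℕ) (D : Finset ℕ) : SimpleGraph (ZMod n) :=
  SimpleGraph.circulantGraph (⋃ d ∈ D, gcdClass n d)

/-- A Boolean matrix: all entries are `0` or `1`. -/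
def IsBooleanMatrix {V : Type*} (C : Matrix V V ℂ) : Prop :=
  ∀ i j, C i j = 0 ∨ C i j = 1

/-- A circulant matrix: the entry at `(j, k)` is the entry `k - j` of the first row. -/
def IsCirculantMatrix {n : ℕ} (C : Matrix (ZMod n) (ZMod n) ℂ) : Prop :=
  ∀ j k, C j k = C 0 (k - j)

/-- The first row is a palindrome: `c_j = c_{n - 1 - j}` (where `n - 1 - j = -1 - j` modulo `n`). -/
def IsPalindromicRow {n : ℕ} (C : Matrix (ZMod n) (ZMod n) ℂ) : Prop :=
  ∀ j, C 0 j = C 0 (-1 - j)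

/-- The join of two copies of `G` along a Boolean matrix `C`: the copies are `Sum.inl` (copy `0`)
and `Sum.inr` (copy `1`), and vertex `a` of copy `0` is joined to vertex `b` of copy `1` when
`C a b = 1`. -/
def matrixJoin {V : Type*} (G : SimpleGraph V) (C : Matrix V V ℂ) : SimpleGraph (V ⊕ V) where
  Adj x y :=
    match x, y with
    | Sum.inl a, Sum.inl b => G.Adj a b
    | Sum.inl a, Sum.inr b => C a b = 1
    | Sum.inr a, Sum.inl b => C b a = 1
    | Sum.inr a, Sum.inr b => G.Adj a b
  symm := ⟨by
    rintro (a | a) (b | b) h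
    · exact SimpleGraph.Adj.symm h
    · exact h
    · exact h
    · exact SimpleGraph.Adj.symm h⟩
  loopless := ⟨by
    rintro (a | a) h
    · exact G.irrefl h
    · exact G.irrefl h⟩

open Classical in
/-- The adjacency matrix of the join has the blocks `A_G`, `C`, `Cᵀ`, `A_G`. -/
theorem matrixJoin_adjMatrix {V : Type*} (G : SimpleGraph V) (C : Matrix V V ℂ)
    (hC : IsBooleanMatrix C) :
    (matrixJoin G C).adjMatrix ℂ =
      Matrix.fromBlocks (G.adjMatrix ℂ) C C.transpose (G.adjMatrix ℂ) := by
  ext (a | a) (b | b)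
  · change (if G.Adj a b then (1 : ℂ) else 0) = if G.Adj a b then 1 else 0
    rfl
  · change (if C a b = 1 then (1 : ℂ) else 0) = C a b
    rcases hC a b with h | h <;> simp [h]
  · change (if C b a = 1 then (1 : ℂ) else 0) = C b a
    rcases hC b a with h | h <;> simp [h]
  · change (if G.Adj a b then (1 : ℂ) else 0) = if G.Adj a b then 1 else 0
    rfl

open Classical in
/-- Perfect state transfer on `G` from `a` to `b` at time `t`: `|⟨b| exp(-i t A_G) |a⟩| = 1`. -/
noncomputable def HasPerfectStateTransfer {V : Type*} [Fintype V]
    (G : SimpleGraph V) (a b : V) (t : ℝ) : Prop :=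
  ‖(NormedSpace.exp ((-(Complex.I * (t : ℂ))) • G.adjMatrix ℂ) : Matrix V V ℂ) b a‖ = 1

/-!
The connection matrix is forced by the identification `(v, s) ↦ 2v + s`: a vertex `2j` and a vertex
`2k + 1` of `ICG_{2n}(2D ∪ Q)` are adjacent when `gcd (2n, 2(k - j) + 1) ∈ Q`, because all elements
of `2D` are even. This condition depends only on `k - j`, and it is unchanged when `2(k - j) + 1` is
negated, which is the palindrome property (`oddClassMatrix`, `matrixJoinIso`). Differences of two
even or of two odd vertices are even, so they see only `2D`, as all elements of `Q` are odd.

Perfect state transfer is proved without eigenvectors. Let `N = 2n` and, for `e ∣ N`, let `E_e` be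
the matrix on `ℤ/N` whose `(i, j)` entry is `1` when `e ∣ i - j` and `0` otherwise
(`divisibilityMatrix`). These matrices commute and `E_e ^ 2 = (N / e) E_e`, so that
`exp (s E_e) = 1 + ((exp (s N / e) - 1) / (N / e)) E_e`. For `s = -iπ/2` it follows that
`exp (s w E_e) = 1` for every integer `w` as soon as `4 ∣ N / e`.

Now `2D ∪ Q = {K} ∪ T`, where `K` is `N / 4` or `N / 2` and `T = {2} ∪ Q` consists of divisors of
`4m` that are not multiples of `4`. Since `N` is a power of two times `4m`, the condition
`gcd (N, x) ∈ T` is the same as `gcd (4m, x) ∈ T`, and Möbius inversion writes its indicator as an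
integral combination of the indicators of `e ∣ x` with `e ∣ 4m`. As `4 ∣ N / (4m)`, the adjacency
matrix of the class `T` has trivial exponential at time `π/2`. The adjacency matrix of the class `K`
is `E_K - E_{2K}`, and its exponential is, up to a factor of modulus one, `1 - E_{N/2}`, that is,
minus the translation by `N / 2 = n`.
-/

/-! ### Exponentials of matrices -/

/-- If `A * A = r • A`, then `r⁻¹ • A` is idempotent, so every term of the exponential
series of `s • A` except the constant one is a scalar multiple of `A`. -/
theorem exp_smul_of_mul_self_eq_smul {𝔸 : Type*} [NormedRing 𝔸] [NormedAlgebra ℂ 𝔸]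
    [NormedAlgebra ℚ 𝔸] [CompleteSpace 𝔸] {A : 𝔸} {r : ℂ} (hr : r ≠ 0) (hA : A * A = r • A)
    (s : ℂ) :
    NormedSpace.exp (s • A) = 1 + ((Complex.exp (s * r) - 1) / r) • A := by
  have hpow : ∀ k : ℕ, A ^ (k + 1) = r ^ k • A := by
    intro k
    induction k with
    | zero => simp
    | succ k ih => rw [pow_succ, ih, smul_mul_assoc, hA, smul_smul, pow_succ]
  have h1 := NormedSpace.exp_series_hasSum_exp' (𝕂 := ℂ) (s • A)
  have h2 : HasSum (fun k : ℕ => ((k.factorial : ℂ)⁻¹ • (s * r) ^ k)) (Complex.exp (s * r)) := by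
    rw [Complex.exp_eq_exp_ℂ]
    exact NormedSpace.exp_series_hasSum_exp' (𝕂 := ℂ) (s * r)
  -- The scalar series multiplied by `r⁻¹ • A` has the constant term `r⁻¹ • A` instead of `1`; the
  -- second summand corrects it.
  have h3 := ((h2.mul_right r⁻¹).smul_const A).add (hasSum_ite_eq (0 : ℕ) (1 - r⁻¹ • A))
  refine (h1.unique (h3.congr_fun ?_)).trans ?_
  · rintro (_ | k)
    · simp
    · simp only [smul_pow, hpow, smul_smul, smul_eq_mul]
      simp only [Nat.add_eq_zero_iff, one_ne_zero, and_false, if_false, add_zero]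
      congr 1
      rw [mul_pow, pow_succ r]
      field_simp
  · rw [sub_div, sub_smul, div_eq_mul_inv, one_div]
    abel

namespace Matrix

variable {V W : Type*} [Fintype V] [DecidableEq V] [Fintype W] [DecidableEq W]

theorem exp_smul_of_mul_self_eq_smul {A : Matrix V V ℂ} {r : ℂ} (hr : r ≠ 0)
    (hA : A * A = r • A) (s : ℂ) :
    NormedSpace.exp (s • A) = 1 + ((Complex.exp (s * r) - 1) / r) • A := by
  open scoped Norms.Operator in
  exact _root_.exp_smul_of_mul_self_eq_smul hr hA s

theorem exp_reindex (e : V ≃ W) (A : Matrix V V ℂ) :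
    NormedSpace.exp (A.reindex e e) = (NormedSpace.exp A).reindex e e := by
  have hc : Continuous (reindexAlgEquiv ℂ ℂ e) := by
    change Continuous fun A : Matrix V V ℂ => A.submatrix e.symm e.symm
    fun_prop
  open scoped Norms.Operator in
  exact (NormedSpace.map_exp (reindexAlgEquiv ℂ ℂ e) hc A).symm

end Matrix

/-! ### Perfect state transfer and isomorphisms -/

theorem HasPerfectStateTransfer.of_iso {V W : Type*} [Fintype V] [Fintype W]
    {G : SimpleGraph V} {H : SimpleGraph W} (f : G ≃g H) {a b : V} {t : ℝ}
    (h : HasPerfectStateTransfer H (f a) (f b) t) : HasPerfectStateTransfer G a b t := by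
  classical
  unfold HasPerfectStateTransfer at h ⊢
  have hA : (H.adjMatrix ℂ).reindex f.symm.toEquiv f.symm.toEquiv = G.adjMatrix ℂ := by
    exact f.symm.reindex_adjMatrix ℂ
  have hexp := Matrix.exp_reindex f.symm.toEquiv ((-(Complex.I * (t : ℂ))) • H.adjMatrix ℂ)
  have hsmul : ((-(Complex.I * (t : ℂ))) • H.adjMatrix ℂ).reindex f.symm.toEquiv f.symm.toEquiv =
      (-(Complex.I * (t : ℂ))) • G.adjMatrix ℂ := by
    rw [← hA]
    rfl
  rw [hsmul] at hexp
  have hab := congr_fun₂ hexp b a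
  have hab' : _ = NormedSpace.exp ((-(Complex.I * (t : ℂ))) • H.adjMatrix ℂ) (f b) (f a) := hab
  convert h

/-! ### Divisibility matrices -/

/-- The circulant matrix of the indicator function of the multiples of `e` modulo `N`. It is meant
for `e ∣ N`, where `e ∣ x.val` does not depend on the representative and the multiples of `e` form
a subgroup of order `N / e`. -/
def divisibilityMatrix (N e : ℕ) : Matrix (ZMod N) (ZMod N) ℂ :=
  Matrix.circulant fun x => if e ∣ x.val then 1 else 0

theorem divisibilityMatrix_apply (N e : ℕ) (i j : ZMod N) :
    divisibilityMatrix N e i j = if e ∣ (i - j).val then 1 else 0 := rfl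

theorem commute_divisibilityMatrix (N : ℕ) [NeZero N] (d e : ℕ) :
    Commute (divisibilityMatrix N d) (divisibilityMatrix N e) :=
  Matrix.circulant_mul_comm _ _

theorem divisibilityMatrix_self (N : ℕ) [NeZero N] : divisibilityMatrix N N = 1 := by
  ext i j
  have : N ∣ (i - j).val ↔ i = j := by
    rw [← ZMod.natCast_eq_zero_iff, ZMod.natCast_zmod_val, sub_eq_zero]
  simp [divisibilityMatrix_apply, Matrix.one_apply, this]

theorem dvd_val_iff_mem_zmultiples {N e : ℕ} [NeZero N] (he : e ∣ N) (x : ZMod N) :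
    e ∣ x.val ↔ x ∈ AddSubgroup.zmultiples (e : ZMod N) := by
  rw [AddSubgroup.mem_zmultiples_iff]
  constructor
  · rintro ⟨c, hc⟩
    refine ⟨c, ?_⟩
    rw [← ZMod.natCast_zmod_val x, hc]
    simp [mul_comm]
  · rintro ⟨k, rfl⟩
    have : ((k • (e : ZMod N)).val : ℤ) = (k * e) % N := by
      rw [← ZMod.val_intCast]
      simp
    rw [← Int.natCast_dvd_natCast, this]
    exact (EuclideanDomain.dvd_mod_iff (by exact_mod_cast he)).2 (dvd_mul_left _ _)

theorem divisibilityMatrix_mul_self {N e : ℕ} [NeZero N] (he : e ∣ N) :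
    divisibilityMatrix N e * divisibilityMatrix N e =
      ((N / e : ℕ) : ℂ) • divisibilityMatrix N e := by
  classical
  set H := AddSubgroup.zmultiples (e : ZMod N) with hH
  have hcard : Fintype.card H = N / e := by
    rw [Fintype.card_zmultiples, ZMod.addOrderOf_coe _ (NeZero.ne N), Nat.gcd_eq_right he]
  ext i j
  simp only [Matrix.mul_apply, Matrix.smul_apply, divisibilityMatrix_apply,
    dvd_val_iff_mem_zmultiples he, ← hH, smul_eq_mul]
  by_cases hij : i - j ∈ H
  · have key : ∀ k, (if i - k ∈ H then (1 : ℂ) else 0) * (if k - j ∈ H then 1 else 0) =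
        if i - k ∈ H then 1 else 0 := fun k => by
      by_cases h1 : i - k ∈ H
      · have h2 : k - j ∈ H := by simpa using H.sub_mem hij h1
        simp [h1, h2]
      · simp [h1]
    have hsub : (∑ k, if i - k ∈ H then (1 : ℂ) else 0) = ∑ k, if k ∈ H then 1 else 0 :=
      (Equiv.subLeft i).sum_comp fun k => if k ∈ H then (1 : ℂ) else 0
    rw [Finset.sum_congr rfl fun k _ => key k, hsub, if_pos hij,
      Finset.sum_boole, mul_one, ← hcard, Fintype.card_subtype]
  · rw [if_neg hij, mul_zero]
    refine Finset.sum_eq_zero fun k _ => ?_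
    by_cases h1 : i - k ∈ H
    · have h2 : k - j ∉ H := fun h2 => hij (by simpa using H.add_mem h1 h2)
      simp [h2]
    · simp [h1]

/-! ### Greatest common divisors and integral circulant graphs -/

/-- The gcd classes modulo `N` can be read off from any integer representative. -/
theorem gcd_val_intCast (N : ℕ) [NeZero N] (z : ℤ) :
    Nat.gcd N (z : ZMod N).val = Int.gcd N z := by
  rw [← Int.gcd_natCast_natCast, ZMod.val_intCast, Int.gcd_comm, Int.gcd_emod, Int.gcd_comm]

theorem gcd_pow_two_mul_eq_iff {K j : ℕ} (hK : 0 < K) (hj : j ≠ 0) (x : ℕ) :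
    Nat.gcd (2 ^ j * K) x = K ↔ K ∣ x ∧ ¬ 2 * K ∣ x := by
  constructor
  · intro h
    refine ⟨h ▸ Nat.gcd_dvd_right _ _, fun h2 => ?_⟩
    have := Nat.dvd_gcd (Nat.mul_dvd_mul_right (dvd_pow_self 2 hj) K) h2
    rw [h] at this
    have := Nat.le_of_dvd hK this
    omega
  · rintro ⟨⟨y, rfl⟩, h⟩
    rw [mul_comm 2 K, Nat.mul_dvd_mul_iff_left hK] at h
    have : Nat.Coprime (2 ^ j) y := ((Nat.prime_two.coprime_iff_not_dvd).2 h).pow_left j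
    rw [mul_comm _ K, Nat.gcd_mul_left, this.gcd_eq_one, mul_one]

/-- If the elements of `T` divide `4m` and are not multiples of `4`, then higher powers of two in
the modulus do not affect membership of the greatest common divisor in `T`: a divisor of
`2 ^ v * (4 * m)` that is not a multiple of `4` divides `4 * m`. -/
theorem gcd_mem_iff_gcd_four_mul_mem {m v : ℕ} {T : Finset ℕ}
    (hT : ∀ d ∈ T, d ∣ 4 * m ∧ ¬ 4 ∣ d) (x : ℕ) :
    Nat.gcd (2 ^ v * (4 * m)) x ∈ T ↔ Nat.gcd (4 * m) x ∈ T := by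
  suffices h : ¬ 4 ∣ Nat.gcd (2 ^ v * (4 * m)) x →
      Nat.gcd (2 ^ v * (4 * m)) x = Nat.gcd (4 * m) x by
    have h4 : 4 ∣ Nat.gcd (2 ^ v * (4 * m)) x → 4 ∣ Nat.gcd (4 * m) x := fun h =>
      Nat.dvd_gcd (dvd_mul_right _ _) (h.trans (Nat.gcd_dvd_right _ _))
    constructor
    · intro hd
      rwa [← h (hT _ hd).2]
    · intro hd
      rwa [h (mt h4 (hT _ hd).2)]
  intro h4
  refine Nat.dvd_antisymm (Nat.dvd_gcd ?_ (Nat.gcd_dvd_right _ _))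
    (Nat.gcd_dvd_gcd_of_dvd_left x (dvd_mul_left _ _))
  have hd := Nat.gcd_dvd_left (2 ^ v * (4 * m)) x
  generalize Nat.gcd (2 ^ v * (4 * m)) x = d at hd h4
  replace hd : d ∣ 2 ^ (v + 2) * m := by
    rwa [show 2 ^ (v + 2) * m = 2 ^ v * (4 * m) by ring]
  have odd_case : ∀ b, ¬ 2 ∣ b → b ∣ 2 ^ (v + 2) * m → b ∣ m := fun b hb h =>
    (((Nat.prime_two.coprime_iff_not_dvd).2 hb).symm.pow_right _).dvd_of_dvd_mul_left h
  by_cases h2 : 2 ∣ d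
  · obtain ⟨b, rfl⟩ := h2
    have hb : ¬ 2 ∣ b := fun h => h4 (by obtain ⟨c, rfl⟩ := h; exact ⟨c, by ring⟩)
    have := odd_case b hb ((dvd_mul_left b 2).trans hd)
    exact mul_dvd_mul (by norm_num) this
  · exact (odd_case d h2 hd).mul_left 4

/-- Möbius inversion, with the coefficients left implicit. -/
theorem exists_sum_divisors_eq (g : ℕ → ℤ) :
    ∃ w : ℕ → ℤ, ∀ d > 0, ∑ e ∈ d.divisors, w e = g d :=
  ⟨_, ArithmeticFunction.sum_eq_iff_sum_smul_moebius_eq.2 fun _ _ => rfl⟩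

/-- Without the class of `N`, which would be that of the zero difference, the condition `i ≠ j` is
automatic; and the gcd classes are closed under negation. -/
theorem integralCirculant_adj_iff {N : ℕ} [NeZero N] {S : Finset ℕ} (hS : N ∉ S)
    (i j : ZMod N) :
    (integralCirculant N S).Adj i j ↔ Nat.gcd N (i - j).val ∈ S := by
  have hsymm : Nat.gcd N (j - i).val = Nat.gcd N (i - j).val := by
    have h (x : ZMod N) : Nat.gcd N (-x).val = Nat.gcd N x.val := by
      obtain ⟨z, rfl⟩ := ZMod.intCast_surjective x
      rw [← Int.cast_neg, gcd_val_intCast, gcd_val_intCast, Int.gcd_neg]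
    rw [← h, neg_sub]
  rw [integralCirculant, SimpleGraph.circulantGraph_adj]
  simp only [gcdClass, Set.mem_iUnion, Set.mem_ofPred_eq, hsymm, sub_ne_zero, exists_prop]
  constructor
  · grind
  · intro h
    have : i ≠ j := by
      rintro rfl
      simp at h
      exact hS h
    grind

/-! ### Perfect state transfer on integral circulant graphs -/

theorem exp_smul_divisibilityMatrix {N e : ℕ} [NeZero N] (he : e ∣ N) (s : ℂ) :
    NormedSpace.exp (s • divisibilityMatrix N e) =
      1 + ((Complex.exp (s * (N / e : ℕ)) - 1) / (N / e : ℕ)) • divisibilityMatrix N e :=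
  Matrix.exp_smul_of_mul_self_eq_smul
    (Nat.cast_ne_zero.2 (Nat.div_pos (Nat.le_of_dvd (NeZero.pos N) he)
      (Nat.pos_of_dvd_of_pos he (NeZero.pos N))).ne') (divisibilityMatrix_mul_self he) s

/-- The nonzero eigenvalue `N / e` of the divisibility matrix is a multiple of `4`, so at time
`π / 2` it contributes an integral multiple of `2πi` to the exponent. -/
theorem exp_int_mul_smul_divisibilityMatrix_eq_one {N e : ℕ} [NeZero N] (he : 4 * e ∣ N) (w : ℤ) :
    NormedSpace.exp
      ((-(Complex.I * ((Real.pi / 2 : ℝ) : ℂ)) * w) • divisibilityMatrix N e) = 1 := by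
  rw [exp_smul_divisibilityMatrix ((dvd_mul_left e 4).trans he)]
  obtain ⟨c, rfl⟩ := he
  have he0 : 0 < e := Nat.pos_of_ne_zero fun h => NeZero.ne (4 * e * c) (by simp [h])
  have h4 : 4 * e * c / e = 4 * c := by
    rw [show 4 * e * c = e * (4 * c) by ring, Nat.mul_div_cancel_left _ he0]
  have : -(Complex.I * ((Real.pi / 2 : ℝ) : ℂ)) * w * ((4 * c : ℕ) : ℂ) =
      ((-w * c : ℤ) : ℂ) * (2 * Real.pi * Complex.I) := by
    push_cast
    ring
  rw [h4, this, Complex.exp_int_mul_two_pi_mul_I]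
  simp

theorem exp_smul_sum_divisibilityMatrix_eq_one {N M : ℕ} [NeZero N] (hM : 4 * M ∣ N) (w : ℕ → ℤ) :
    NormedSpace.exp (-(Complex.I * ((Real.pi / 2 : ℝ) : ℂ)) •
      ∑ e ∈ M.divisors, (w e : ℂ) • divisibilityMatrix N e) = 1 := by
  rw [Finset.smul_sum, Matrix.exp_sum_of_commute]
  · refine (Finset.noncommProd_eq_pow_card _ _ _ 1 fun e he => ?_).trans (one_pow _)
    rw [smul_smul]
    exact exp_int_mul_smul_divisibilityMatrix_eq_one
      ((mul_dvd_mul_left 4 (Nat.dvd_of_mem_divisors he)).trans hM) _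
  · intro d _ e _ _
    exact ((commute_divisibilityMatrix N d e).smul_left _ |>.smul_right _).smul_left _
      |>.smul_right _

/-- For `K = L / 2` and for `K = L`, the matrix
`divisibilityMatrix (2L) K - divisibilityMatrix (2L) (2K)` is the adjacency matrix of the gcd class of `K` modulo `2L`. At time
`π / 2` its exponential is a scalar of modulus one times `1 - divisibilityMatrix (2L) L`, which is
minus the translation by `L`. -/
theorem norm_exp_divisibilityMatrix_sub_apply {L K : ℕ} [NeZero (2 * L)]
    (hK : 2 * K = L ∨ K = L) :
    ‖NormedSpace.exp (-(Complex.I * ((Real.pi / 2 : ℝ) : ℂ)) •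
      (divisibilityMatrix (2 * L) K - divisibilityMatrix (2 * L) (2 * K)))
        (L : ZMod (2 * L)) 0‖ = 1 := by
  set s := -(Complex.I * ((Real.pi / 2 : ℝ) : ℂ)) with hs
  have hL : 0 < L := by have := NeZero.pos (2 * L); omega
  have hdiv : 2 * L / L = 2 := Nat.mul_div_cancel _ hL
  have hLval : (L : ZMod (2 * L)).val = L := ZMod.val_natCast_of_lt (by omega)
  have hentry : divisibilityMatrix (2 * L) L (L : ZMod (2 * L)) 0 = 1 := by
    simp [divisibilityMatrix_apply, hLval]
  have hne : (L : ZMod (2 * L)) ≠ 0 := fun h => by simp [h] at hLval; omega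
  rw [sub_eq_add_neg, smul_add, Matrix.exp_add_of_commute _ _
    (((commute_divisibilityMatrix (2 * L) K (2 * K)).neg_right.smul_left _).smul_right _)]
  rcases hK with hK | rfl
  -- If `2K = L`, the first exponential is trivial, the second `1 - divisibilityMatrix (2L) L`.
  · have h1 := exp_int_mul_smul_divisibilityMatrix_eq_one (N := 2 * L) (e := K) ⟨1, by omega⟩ 1
    rw [Int.cast_one, mul_one, ← hs] at h1
    have h2 : -s * (2 : ℕ) = Real.pi * Complex.I := by
      rw [hs]
      push_cast
      ring
    rw [h1, one_mul, hK, smul_neg, ← neg_smul, exp_smul_divisibilityMatrix (dvd_mul_left L 2), hdiv,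
      h2, Complex.exp_pi_mul_I, Matrix.add_apply, Matrix.smul_apply, hentry,
      Matrix.one_apply_ne hne]
    norm_num
  -- If `K = L`, the first exponential is `1 - divisibilityMatrix (2L) L` and the second is scalar,
  -- because `divisibilityMatrix (2L) (2L) = 1`.
  · have h2 : s * (2 : ℕ) = -(Real.pi * Complex.I) := by
      rw [hs]
      push_cast
      ring
    have h3 : ‖Complex.exp (-s)‖ = 1 := by
      rw [hs, neg_neg, mul_comm, Complex.norm_exp_ofReal_mul_I]
    have h4 : NormedSpace.exp (s • -divisibilityMatrix (2 * K) (2 * K)) =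
        Complex.exp (-s) • (1 : Matrix (ZMod (2 * K)) (ZMod (2 * K)) ℂ) := by
      rw [smul_neg, ← neg_smul, exp_smul_divisibilityMatrix dvd_rfl, divisibilityMatrix_self,
        Nat.div_self (by omega), Nat.cast_one, mul_one, div_one, sub_smul, one_smul]
      abel
    rw [h4, exp_smul_divisibilityMatrix (dvd_mul_left K 2), hdiv, h2, Complex.exp_neg,
      Complex.exp_pi_mul_I, mul_smul_comm, mul_one, Matrix.smul_apply, norm_smul, h3, one_mul,
      Matrix.add_apply, Matrix.smul_apply, hentry, Matrix.one_apply_ne hne]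
    norm_num

/-- Modulo `2L`, the gcd class of `K ∈ {L / 2, L}` alone transfers `0` to `L` at time `π / 2`, and
the classes in `T` do not interfere, their adjacency matrix having trivial exponential at that
time. -/
theorem hasPerfectStateTransfer_integralCirculant {v m L K : ℕ} [NeZero (2 * L)]
    (hL : 2 * L = 2 ^ v * (4 * m)) (hv : 2 ≤ v) (hK : 2 * K = L ∨ K = L)
    {T : Finset ℕ} (hT : ∀ d ∈ T, d ∣ 4 * m ∧ ¬ 4 ∣ d) :
    HasPerfectStateTransfer (integralCirculant (2 * L) (insert K T)) 0 (L : ZMod (2 * L))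
      (Real.pi / 2) := by
  classical
  obtain ⟨j, rfl⟩ : ∃ j, v = j + 2 := ⟨v - 2, by omega⟩
  have hL0 : 0 < L := by have := NeZero.pos (2 * L); omega
  have hm : 0 < m := Nat.pos_of_ne_zero fun h => by simp [h] at hL; omega
  have hK4 : 4 ∣ K := by
    have h8 : L = 8 * (2 ^ j * m) := by
      have : 2 ^ (j + 2) * (4 * m) = 2 * (8 * (2 ^ j * m)) := by ring
      omega
    omega
  have hKT : K ∉ T := fun h => (hT K h).2 hK4
  have hNS : 2 * L ∉ insert K T := by
    rw [Finset.mem_insert, not_or]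
    exact ⟨by omega, fun h => (hT _ h).2 (by omega)⟩
  obtain ⟨w, hw⟩ := exists_sum_divisors_eq fun d => if d ∈ T then 1 else 0
  have hA : (integralCirculant (2 * L) (insert K T)).adjMatrix ℂ =
      ∑ e ∈ (4 * m).divisors, (w e : ℂ) • divisibilityMatrix (2 * L) e +
        (divisibilityMatrix (2 * L) K - divisibilityMatrix (2 * L) (2 * K)) := by
    ext a b
    rw [SimpleGraph.adjMatrix_apply, integralCirculant_adj_iff hNS]
    simp only [Matrix.add_apply, Matrix.sub_apply, Matrix.sum_apply, Matrix.smul_apply,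
      divisibilityMatrix_apply, smul_eq_mul, mul_ite, mul_one, mul_zero]
    generalize (a - b).val = x
    have h1 : (∑ e ∈ (4 * m).divisors, if e ∣ x then (w e : ℂ) else 0) =
        if Nat.gcd (2 * L) x ∈ T then 1 else 0 := by
      rw [hL, if_congr (gcd_mem_iff_gcd_four_mul_mem hT x) rfl rfl, ← Finset.sum_filter]
      have hdiv : (4 * m).divisors.filter (· ∣ x) = (Nat.gcd (4 * m) x).divisors := by
        ext e
        simp [Nat.dvd_gcd_iff, hm.ne']
      have := hw (Nat.gcd (4 * m) x) (Nat.gcd_pos_of_pos_left _ (by omega))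
      rw [hdiv, ← Int.cast_sum, this]
      split_ifs <;> simp
    have h2 : Nat.gcd (2 * L) x = K ↔ K ∣ x ∧ ¬ 2 * K ∣ x := by
      rcases hK with hK | rfl
      · rw [← gcd_pow_two_mul_eq_iff (j := 2) (by omega) two_ne_zero,
          show 2 ^ 2 * K = 2 * L by omega]
      · rw [← gcd_pow_two_mul_eq_iff (j := 1) hL0 one_ne_zero, pow_one]
    have h3 : 2 * K ∣ x → K ∣ x := (dvd_mul_left K 2).trans
    rw [h1, Finset.mem_insert]
    by_cases hgK : Nat.gcd (2 * L) x = K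
    · have hgT : Nat.gcd (2 * L) x ∉ T := hgK ▸ hKT
      simp [hgK, hKT, (h2.1 hgK).1, (h2.1 hgK).2]
    · have h4 : K ∣ x ↔ 2 * K ∣ x := ⟨fun h => by_contra fun h' => hgK (h2.2 ⟨h, h'⟩), h3⟩
      simp [hgK, h4]
  have hsum : Commute (∑ e ∈ (4 * m).divisors, (w e : ℂ) • divisibilityMatrix (2 * L) e)
      (divisibilityMatrix (2 * L) K - divisibilityMatrix (2 * L) (2 * K)) :=
    Commute.sum_left _ _ _ fun e _ => ((commute_divisibilityMatrix (2 * L) e K).sub_right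
      (commute_divisibilityMatrix (2 * L) e (2 * K))).smul_left _
  have hmain := norm_exp_divisibilityMatrix_sub_apply hK
  unfold HasPerfectStateTransfer
  have hexp : NormedSpace.exp (-(Complex.I * ((Real.pi / 2 : ℝ) : ℂ)) •
      (integralCirculant (2 * L) (insert K T)).adjMatrix ℂ) =
      NormedSpace.exp (-(Complex.I * ((Real.pi / 2 : ℝ) : ℂ)) •
        (divisibilityMatrix (2 * L) K - divisibilityMatrix (2 * L) (2 * K))) := by
    rw [hA, smul_add, Matrix.exp_add_of_commute _ _ ((hsum.smul_left _).smul_right _),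
      exp_smul_sum_divisibilityMatrix_eq_one, one_mul]
    rw [hL, show 2 ^ (j + 2) * (4 * m) = 4 * (4 * m) * 2 ^ j by ring]
    exact dvd_mul_right _ _
  rw [← hexp] at hmain
  convert hmain

/-! ### The connection matrix and the join -/

/-- The connection matrix between the even vertices `2j` and the odd vertices `2k + 1` modulo
`2n`: the entry at `(j, k)` records whether `gcd (2n, 2(k - j) + 1)` lies in `Q`. The difference
`k - j` is taken in `ZMod n`; this is harmless, as changing its representative by `n` changes the
second argument of the gcd by `2n`. -/
noncomputable def oddClassMatrix (n : ℕ) (Q : Finset ℕ) : Matrix (ZMod n) (ZMod n) ℂ :=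
  Matrix.of fun j k => if Nat.gcd (2 * n) (2 * (k - j).val + 1) ∈ Q then 1 else 0

theorem oddClassMatrix_apply (n : ℕ) (Q : Finset ℕ) (j k : ZMod n) :
    oddClassMatrix n Q j k = if Nat.gcd (2 * n) (2 * (k - j).val + 1) ∈ Q then 1 else 0 := rfl

theorem isBooleanMatrix_oddClassMatrix (n : ℕ) (Q : Finset ℕ) :
    IsBooleanMatrix (oddClassMatrix n Q) := fun j k => by
  rw [oddClassMatrix_apply]
  split_ifs <;> simp

theorem isCirculantMatrix_oddClassMatrix (n : ℕ) (Q : Finset ℕ) :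
    IsCirculantMatrix (oddClassMatrix n Q) := fun j k => by
  simp [oddClassMatrix_apply]

theorem isPalindromicRow_oddClassMatrix (n : ℕ) [NeZero n] (Q : Finset ℕ) :
    IsPalindromicRow (oddClassMatrix n Q) := fun j => by
  have hj := ZMod.val_lt j
  have hval : (-1 - j).val = n - 1 - j.val := by
    have : (-1 - j) = ((n - 1 - j.val : ℕ) : ZMod n) := by
      rw [Nat.cast_sub (by omega), Nat.cast_sub (by omega)]
      simp
    rw [this, ZMod.val_natCast_of_lt (by omega)]
  have : 2 * (n - 1 - j.val) + 1 = 2 * n - (2 * j.val + 1) := by omega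
  rw [oddClassMatrix_apply, oddClassMatrix_apply, sub_zero, sub_zero, hval, this,
    Nat.gcd_self_sub_right (by omega)]

/-- An identity matrix of size at least two has no palindromic first row. -/
theorem oddClassMatrix_ne_one {n : ℕ} [NeZero n] (hn : n ≠ 1) (Q : Finset ℕ) :
    oddClassMatrix n Q ≠ 1 := fun h => by
  have : Fact (1 < n) := ⟨by have := NeZero.ne n; omega⟩
  have hp := isPalindromicRow_oddClassMatrix n Q 0
  rw [h, sub_zero, Matrix.one_apply_eq, Matrix.one_apply_ne (neg_ne_zero.2 one_ne_zero).symm] at hp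
  exact one_ne_zero hp

/-- For odd `q ∣ n`, column `(q - 1) / 2` (here `q / 2` in truncating division) of the first row
tests whether `q ∈ Q`, as `2 * ((q - 1) / 2) + 1 = q`. -/
theorem oddClassMatrix_apply_half {n q : ℕ} [NeZero n] (hq : q ∣ n) (hodd : Odd q)
    (Q : Finset ℕ) :
    oddClassMatrix n Q 0 ((q / 2 : ℕ) : ZMod n) = if q ∈ Q then 1 else 0 := by
  have hle := Nat.le_of_dvd (NeZero.pos n) hq
  have hpos := hodd.pos
  rw [oddClassMatrix_apply, sub_zero, ZMod.val_natCast_of_lt (by omega),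
    Nat.two_mul_div_two_add_one_of_odd hodd, Nat.gcd_eq_right (hq.mul_left 2)]

/-- The identification `(v, s) ↦ 2v + s` of two copies of the residues modulo `n` with the residues
modulo `2n`, where `v` is represented in `{0, …, n - 1}`. -/
noncomputable def interleave (n : ℕ) [NeZero n] : ZMod n ⊕ ZMod n ≃ ZMod (2 * n) :=
  Equiv.ofBijective
    (Sum.elim (fun v => ((2 * v.val : ℕ) : ZMod (2 * n)))
      fun v => ((2 * v.val + 1 : ℕ) : ZMod (2 * n))) <| by
    have hinj : ∀ a b : ℕ, a < 2 * n → b < 2 * n →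
        ((a : ℕ) : ZMod (2 * n)) = ((b : ℕ) : ZMod (2 * n)) → a = b := fun a b ha hb h => by
      rw [← ZMod.val_natCast_of_lt ha, h, ZMod.val_natCast_of_lt hb]
    rw [Fintype.bijective_iff_injective_and_card]
    constructor
    · rintro (a | a) (b | b) h <;> have ha := ZMod.val_lt a <;> have hb := ZMod.val_lt b <;>
        have := hinj _ _ (by omega) (by omega) h
      · exact congrArg _ (ZMod.val_injective n (by omega))
      · omega
      · omega
      · exact congrArg _ (ZMod.val_injective n (by omega))
    · simp [ZMod.card, two_mul]

theorem interleave_adj_iff {n : ℕ} [NeZero n] {D Q : Finset ℕ} (hD : n ∉ D)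
    (hQ : ∀ q ∈ Q, Odd q) (x y : ZMod n ⊕ ZMod n) :
    (integralCirculant (2 * n) (D.image (fun d => 2 * d) ∪ Q)).Adj
      (interleave n x) (interleave n y) ↔
      (matrixJoin (integralCirculant n D) (oddClassMatrix n Q)).Adj x y := by
  have hS : 2 * n ∉ D.image (fun d => 2 * d) ∪ Q := by
    rw [Finset.mem_union, Finset.mem_image, not_or]
    refine ⟨?_, fun h => ?_⟩
    · rintro ⟨d, hd, h⟩
      exact hD (by rwa [← show d = n by omega])
    · have := hQ _ h
      grind
  have hdiff (a b : ℕ) : Nat.gcd (2 * n) ((a : ZMod (2 * n)) - (b : ZMod (2 * n))).val =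
      Int.gcd (2 * n : ℕ) ((a : ℤ) - b) := by
    rw [← gcd_val_intCast]
    push_cast
    rfl
  have heven (a b : ZMod n) : Int.gcd (2 * n : ℕ) ((2 * a.val : ℕ) - (2 * b.val : ℕ) : ℤ) ∈
      D.image (fun d => 2 * d) ∪ Q ↔ Nat.gcd n (a - b).val ∈ D := by
    have h1 : Int.gcd (2 * n : ℕ) ((2 * a.val : ℕ) - (2 * b.val : ℕ) : ℤ) =
        2 * Nat.gcd n (a - b).val := by
      have h2 : a - b = ((a.val - b.val : ℤ) : ZMod n) := by simp
      rw [h2, gcd_val_intCast]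
      push_cast
      rw [← mul_sub, Int.gcd_mul_left]
      rfl
    rw [h1, Finset.mem_union, Finset.mem_image]
    constructor
    · rintro (⟨d, hd, h⟩ | h)
      · rwa [← show d = Nat.gcd n (a - b).val by omega]
      · have := hQ _ h
        grind
    · exact fun h => Or.inl ⟨_, h, rfl⟩
  have hcross (a b : ZMod n) : Int.gcd (2 * n : ℕ) ((2 * b.val + 1 : ℕ) - (2 * a.val : ℕ) : ℤ) ∈
      D.image (fun d => 2 * d) ∪ Q ↔ oddClassMatrix n Q a b = 1 := by
    have h1 : Int.gcd (2 * n : ℕ) ((2 * b.val + 1 : ℕ) - (2 * a.val : ℕ) : ℤ) =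
        Nat.gcd (2 * n) (2 * (b - a).val + 1) := by
      obtain ⟨t, ht⟩ : (n : ℤ) ∣ (b.val - a.val : ℤ) - (b - a).val := by
        rw [← ZMod.intCast_zmod_eq_zero_iff_dvd]
        simp
      have h2 : ((2 * b.val + 1 : ℕ) - (2 * a.val : ℕ) : ℤ) =
          (2 * (b - a).val + 1 : ℕ) + (2 * n : ℕ) * t := by
        push_cast
        linarith
      rw [h2, Int.gcd_add_mul_left_right, Int.gcd_natCast_natCast]
    have hodd : ¬ 2 ∣ Nat.gcd (2 * n) (2 * (b - a).val + 1) := fun h => by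
      have := h.trans (Nat.gcd_dvd_right _ _)
      omega
    rw [h1, oddClassMatrix_apply, Finset.mem_union, Finset.mem_image]
    constructor
    · rintro (⟨d, -, h⟩ | h)
      · exact (hodd ⟨d, h.symm⟩).elim
      · simp [h]
    · intro h
      by_contra h'
      rw [if_neg fun h'' => h' (Or.inr h'')] at h
      exact zero_ne_one h
  rcases x with a | a <;> rcases y with b | b
  · change (integralCirculant _ _).Adj ((2 * a.val : ℕ) : ZMod (2 * n))
      ((2 * b.val : ℕ) : ZMod (2 * n)) ↔ (integralCirculant n D).Adj a b
    rw [integralCirculant_adj_iff hS, integralCirculant_adj_iff hD, hdiff, heven]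
  · change (integralCirculant _ _).Adj ((2 * a.val : ℕ) : ZMod (2 * n))
      ((2 * b.val + 1 : ℕ) : ZMod (2 * n)) ↔ oddClassMatrix n Q a b = 1
    rw [SimpleGraph.adj_comm, integralCirculant_adj_iff hS, hdiff, hcross]
  · change (integralCirculant _ _).Adj ((2 * a.val + 1 : ℕ) : ZMod (2 * n))
      ((2 * b.val : ℕ) : ZMod (2 * n)) ↔ oddClassMatrix n Q b a = 1
    rw [integralCirculant_adj_iff hS, hdiff, hcross]
  · change (integralCirculant _ _).Adj ((2 * a.val + 1 : ℕ) : ZMod (2 * n))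
      ((2 * b.val + 1 : ℕ) : ZMod (2 * n)) ↔ (integralCirculant n D).Adj a b
    rw [integralCirculant_adj_iff hS, integralCirculant_adj_iff hD, hdiff, ← heven]
    push_cast
    rw [add_sub_add_right_eq_sub]

/-- `interleave n` as an isomorphism from the join of two copies of `ICG_n(D)` along
`oddClassMatrix n Q` to `ICG_{2n}(2D ∪ Q)`. -/
noncomputable def matrixJoinIso {n : ℕ} [NeZero n] {D Q : Finset ℕ} (hD : n ∉ D)
    (hQ : ∀ q ∈ Q, Odd q) :
    matrixJoin (integralCirculant n D) (oddClassMatrix n Q) ≃g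
      integralCirculant (2 * n) (D.image (fun d => 2 * d) ∪ Q) where
  toEquiv := interleave n
  map_rel_iff' := interleave_adj_iff hD hQ _ _

/-! ### Boolean circulant connections with perfect state transfer -/

theorem mainTheorem1 (n u m : ℕ) [NeZero n] (hn : n = 2 ^ u * m) (hu : 3 ≤ u)
    (hm : 3 ≤ m) (hodd : Odd m) (D : Finset ℕ) (hD : D = {1, n / 4} ∨ D = {1, n / 2})
    (Q : Finset ℕ) (hQ : Q ⊆ m.divisors) :
    ∃ C : Matrix (ZMod n) (ZMod n) ℂ,
      IsBooleanMatrix C ∧ IsCirculantMatrix C ∧ IsPalindromicRow C ∧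
      C ≠ 1 ∧ (Q.Nonempty → C ≠ 0) ∧ (Q ≠ m.divisors → C ≠ Matrix.of fun _ _ => 1) ∧
      (∃ φ : matrixJoin (integralCirculant n D) C ≃g
          integralCirculant (2 * n) (D.image (fun d => 2 * d) ∪ Q),
        ∀ v : ZMod n, φ (Sum.inl v) = ((2 * v.val : ℕ) : ZMod (2 * n)) ∧
          φ (Sum.inr v) = ((2 * v.val + 1 : ℕ) : ZMod (2 * n))) ∧
      HasPerfectStateTransfer (matrixJoin (integralCirculant n D) C)
        (Sum.inl 0) (Sum.inl ((n / 2 : ℕ) : ZMod n)) (Real.pi / 2) ∧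
      HasPerfectStateTransfer (integralCirculant (2 * n) (D.image (fun d => 2 * d) ∪ Q))
        0 ((n : ℕ) : ZMod (2 * n)) (Real.pi / 2) := by
  obtain ⟨j, rfl⟩ : ∃ j, u = j + 3 := ⟨u - 3, by omega⟩
  have hn8 : n = 8 * (2 ^ j * m) := by rw [hn]; ring
  have hn0 := NeZero.pos n
  have hmn : m ∣ n := hn ▸ dvd_mul_left _ _
  have hdvd_odd : ∀ q, q ∣ m → Odd q := fun q hq => hodd.of_dvd_nat hq
  have hQdvd : ∀ q ∈ Q, q ∣ m := fun q hq => Nat.dvd_of_mem_divisors (hQ hq)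
  have hQodd : ∀ q ∈ Q, Odd q := fun q hq => hdvd_odd q (hQdvd q hq)
  have hnD : n ∉ D := by
    rcases hD with rfl | rfl <;>
    · rw [Finset.mem_insert, Finset.mem_singleton, not_or]
      omega
  have hT : ∀ d ∈ insert 2 Q, d ∣ 4 * m ∧ ¬ 4 ∣ d := by
    intro d hd
    rcases Finset.mem_insert.1 hd with rfl | hd
    · exact ⟨(by norm_num : 2 ∣ 4).mul_right m, by norm_num⟩
    · refine ⟨(hQdvd d hd).mul_left 4, fun h => ?_⟩
      have := hQodd d hd
      grind
  obtain ⟨K, hK, hS⟩ : ∃ K, (2 * K = n ∨ K = n) ∧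
      D.image (fun d => 2 * d) ∪ Q = insert K (insert 2 Q) := by
    rcases hD with rfl | rfl
    · refine ⟨2 * (n / 4), by omega, ?_⟩
      ext
      simp
      grind
    · refine ⟨2 * (n / 2), by omega, ?_⟩
      ext
      simp
      grind
  have hpst : HasPerfectStateTransfer (integralCirculant (2 * n) (D.image (fun d => 2 * d) ∪ Q))
      0 ((n : ℕ) : ZMod (2 * n)) (Real.pi / 2) := by
    rw [hS]
    exact hasPerfectStateTransfer_integralCirculant (v := j + 2) (by rw [hn]; ring) (by omega)
      hK hT
  refine ⟨oddClassMatrix n Q, isBooleanMatrix_oddClassMatrix n Q,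
    isCirculantMatrix_oddClassMatrix n Q, isPalindromicRow_oddClassMatrix n Q,
    oddClassMatrix_ne_one (by omega) Q, ?_, ?_, ⟨matrixJoinIso hnD hQodd, fun v => ⟨rfl, rfl⟩⟩,
    ?_, hpst⟩
  · rintro ⟨q, hq⟩ h
    have := oddClassMatrix_apply_half ((hQdvd q hq).trans hmn) (hQodd q hq) Q
    simp [h, hq] at this
  · intro hne h
    obtain ⟨q, hqm, hq⟩ := Finset.exists_of_ssubset (hQ.ssubset_of_ne hne)
    have hqm := Nat.dvd_of_mem_divisors hqm
    have := oddClassMatrix_apply_half (hqm.trans hmn) (hdvd_odd q hqm) Q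
    simp [h, hq] at this
  · refine HasPerfectStateTransfer.of_iso (matrixJoinIso hnD hQodd) ?_
    have h0 : matrixJoinIso hnD hQodd (Sum.inl 0) = 0 := by
      change ((2 * (0 : ZMod n).val : ℕ) : ZMod (2 * n)) = 0
      simp
    have h1 : matrixJoinIso hnD hQodd (Sum.inl ((n / 2 : ℕ) : ZMod n)) = (n : ZMod (2 * n)) := by
      change ((2 * ((n / 2 : ℕ) : ZMod n).val : ℕ) : ZMod (2 * n)) = n
      rw [ZMod.val_natCast_of_lt (by omega), show 2 * (n / 2) = n by omega]
    rwa [h0, h1]
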